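/- Let $\mathcal C[0,1]$ be the space of continuous maps $[0,1]\to[0,1]$ with the uniform topology. A property of maps is \emph{typical} if it holds for all $f$ in some dense $G_\delta$ subset of $\mathcal C[0,1]$. Let $\mathrm{Leb}$ be Lebesgue measure on $[0,1]$, and give the set of Borel probability measures on $[0,1]$ the weak$^*$ topology, with the distance $$\mathrm{dist}(\mu,\nu)=\sum_{i\ge1}2^{-i}\Big|\int\Psi_i\,d\mu-\int\Psi_i\,d\nu\Big| ,$$ where $(\Psi_i)_{i\ge1}$ is a fixed dense sequence in $\mathcal C[0,1]$. For $f\in\mathcal C[0,1]$ and $x\in[0,1]$ let $p\omega(x)$ be the set of weak$^*$ limits of convergent subsequences of the empirical measures $\frac1n\sum_{j=0}^{n-1}\delta_{f^j(x)}$, $n\ge1$, and let $\mu_x$ be the limit of the whole sequence when it exists. A probability measure $\mu$ is \emph{pseudo-physical} for $f$ if for every $\varepsilon>0$ the set $\{x\in[0,1]:\mathrm{dist}(p\omega(x),\mu)<\varepsilon\}$ has positive Lebesgue measure, where $\mathrm{dist}(p\omega(x),\mu)=\inf_{\nu\in p\omega(x)}\mathrm{dist}(\nu,\mu)$; $\mathcal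 O_f$ is the set of pseudo-physical measures. A \emph{periodic shrinking interval} of period $p\ge1$ is a nonempty open interval $I=(a,b)\subset[0,1]$ such that the sets $f^j(\overline I)$, $0\le j\le p-1$, are pairwise disjoint, $f^p(\overline I)\subset I$, and $\mathrm{length}(f^j(I))<\mathrm{length}(I)$ for $1\le j\le p-1$. An $f$-invariant Borel probability measure $\mu$ is \emph{infinitely shrinked} if there are periodic shrinking intervals $I_q$, $q\ge1$, of periods $p_q$, with $\mathrm{length}(I_q)<1/q$ and $\mu\big(\bigcup_{j=1}^{p_q}f^j(\overline{I_q})\big)=1$ for all $q\ge1$; $\mathrm{Shr}_f$ is the set of these measures. Put $$AA=\{x\in[0,1]:\mu_x\text{ exists and }p\omega(x)=\{\mu_x\}\},\qquad AA_1=\{x\in AA:\mu_x\in\mathcal O_f\},\qquad AA_2=\{x\in AA_1:\mu_x\in\mathrm{Shr}_f\}.$$ Theorem. For a typical map $f\in\mathcal C[0,1]$, the set $AA_2$ is Lebesgue measurable with $$\mathrm{Leb}(AA_2)=1\qquad\text{and}\qquad\mathcal O_f=\overline{\{\mu_x:x\in AA_2\}}=\overline{\mathrm{Shr}_f}.$$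 -/

import Mathlib

open Set Filter Topology MeasureTheory
open scoped unitInterval ENNReal

noncomputable section

namespace PseudoPhysical

/-- A property of continuous maps `[0,1] → [0,1]` is typical if it holds on a dense `Gδ` subset of
the space `C(I, I)` of all such maps with the uniform topology. -/
def Typical (P : C(I, I) → Prop) : Prop :=
  ∃ G : Set C(I, I), IsGδ G ∧ Dense G ∧ ∀ f ∈ G, P f

/-- The distance `∑_{i ≥ 1} 2⁻ⁱ |∫ Ψᵢ dμ - ∫ Ψᵢ dν|` between Borel probability measures on `[0,1]`
given by a sequence `Ψ` in `C(I, I)` (used only for sequences with dense range). The sequence is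
indexed from `0`. -/
def weakDist (Ψ : ℕ → C(I, I)) (μ ν : ProbabilityMeasure I) : ℝ :=
  ∑' i : ℕ, (1 / 2 : ℝ) ^ (i + 1) *
    |(∫ x, (Ψ i x : ℝ) ∂(μ : Measure I)) - ∫ x, (Ψ i x : ℝ) ∂(ν : Measure I)|

/-- The distance from a set of measures to a measure: an infimum, equal to `∞` for the empty
set. -/
def weakDistSet (Ψ : ℕ → C(I, I)) (S : Set (ProbabilityMeasure I))
    (μ : ProbabilityMeasure I) : ℝ≥0∞ :=
  ⨅ ν ∈ S, ENNReal.ofReal (weakDist Ψ ν μ)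

/-- `empirical f x n` is the average of the Dirac measures at the first `n + 1` points
`x, f x, …, f^n x` of the orbit of `x`. -/
def empirical (f : C(I, I)) (x : I) (n : ℕ) : ProbabilityMeasure I :=
  ⟨((n + 1 : ℕ) : ℝ≥0∞)⁻¹ • ∑ j ∈ Finset.range (n + 1), Measure.dirac (f^[j] x), ⟨by
    simp only [Measure.smul_apply, Measure.finsetSum_apply, measure_univ, Finset.sum_const,
      Finset.card_range, nsmul_eq_mul, mul_one, smul_eq_mul]
    exact ENNReal.inv_mul_cancel (by positivity) (ENNReal.natCast_ne_top _)⟩⟩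

/-- `pω(x)`: the weak-* limits of the convergent subsequences of the empirical measures. -/
def pOmega (f : C(I, I)) (x : I) : Set (ProbabilityMeasure I) :=
  {μ | ∃ φ : ℕ → ℕ, StrictMono φ ∧ Tendsto (fun k => empirical f x (φ k)) atTop (𝓝 μ)}

/-- The set `O_f` of pseudo-physical measures of `f`. -/
def pseudoPhysical (Ψ : ℕ → C(I, I)) (f : C(I, I)) : Set (ProbabilityMeasure I) :=
  {μ | ∀ ε : ℝ, 0 < ε →
    0 < (volume : Measure I) {x : I | weakDistSet Ψ (pOmega f x) μ < ENNReal.ofReal ε}}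

/-- The set `M_f` of `f`-invariant Borel probability measures. -/
def invariantMeasures (f : C(I, I)) : Set (ProbabilityMeasure I) :=
  {μ | MeasurePreserving f (μ : Measure I) (μ : Measure I)}

/-- `J` is a periodic shrinking interval of period `p` for `f`. The length of the interval `J`, and
of its image under an iterate of `f` (again an interval), is its Lebesgue measure. -/
structure IsPeriodicShrinking (f : C(I, I)) (p : ℕ) (J : Set I) : Prop where
  one_le : 1 ≤ p
  isOpenInterval : ∃ a b : I, a < b ∧ J = Ioo a b
  disjoint_images : ∀ i < p, ∀ j < p, i ≠ j →
    Disjoint (f^[i] '' closure J) (f^[j] '' closure J)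
  image_subset : f^[p] '' closure J ⊆ J
  length_lt : ∀ j, 1 ≤ j → j < p →
    (volume : Measure I) (f^[j] '' J) < (volume : Measure I) J

/-- The set `Shr_f` of infinitely shrinked invariant measures. -/
def infinitelyShrinked (f : C(I, I)) : Set (ProbabilityMeasure I) :=
  {μ | μ ∈ invariantMeasures f ∧ ∃ (J : ℕ → Set I) (p : ℕ → ℕ), ∀ q : ℕ, 1 ≤ q →
    IsPeriodicShrinking f (p q) (J q) ∧
    (volume : Measure I) (J q) < 1 / (q : ℝ≥0∞) ∧
    (μ : Measure I) (⋃ j ∈ Finset.Icc 1 (p q), f^[j] '' closure (J q)) = 1}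

/-- `μ_x`, the limit of the empirical measures of `x` (meaningful when this limit exists). -/
def limitMeasure (f : C(I, I)) (x : I) : ProbabilityMeasure I :=
  haveI : Nonempty (ProbabilityMeasure I) := ⟨empirical f x 0⟩
  limUnder atTop (empirical f x)

/-- The points `x` for which `μ_x` exists and `pω(x) = {μ_x}`. -/
def AA (f : C(I, I)) : Set I :=
  {x | (∃ μ, Tendsto (empirical f x) atTop (𝓝 μ)) ∧ pOmega f x = {limitMeasure f x}}

/-- The points of `AA` for which `μ_x` is pseudo-physical. -/
def AA₁ (Ψ : ℕ → C(I, I)) (f : C(I, I)) : Set I :=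
  {x | x ∈ AA f ∧ limitMeasure f x ∈ pseudoPhysical Ψ f}

/-- The points of `AA₁` for which `μ_x` is infinitely shrinked. -/
def AA₂ (Ψ : ℕ → C(I, I)) (f : C(I, I)) : Set I :=
  {x | x ∈ AA₁ Ψ f ∧ limitMeasure f x ∈ infinitelyShrinked f}

end PseudoPhysical

end

namespace PseudoPhysical

/-! The theorem reduces to one generic fact: for typical `f`, the orbit of almost every `x` enters
periodic shrinking intervals of arbitrarily small length.

Given this fact, the rest is deterministic. The cycle of a shrinking interval of period `p` consists
of short pieces visited in cyclic order, so Birkhoff sums over one period nearly agree for all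
points of the cycle. Hence any two invariant measures carried by the cycle nearly agree on a fixed
continuous function (`IsPeriodicShrinking.abs_integral_sub_le`, `tendsto_of_cycles`). If an orbit
enters such cycles at every scale, all its limit measures coincide, and the common limit is
infinitely shrinked. Conversely, an infinitely shrinked measure is approximated by `pω(x)` for every
`x` in a short interval, which has positive length, so it is pseudo-physical. A pseudo-physical
measure is a limit of measures `μ_x` because a set of positive measure meets the full-measure set
`AA₂` (`conclusion_of_ae`).

The generic fact is a Baire argument (`typical_ae_capture`). Shrinking is made an open condition on
`f`, so the maps capturing a set of measure greater than `d < 1` form an open set. For density,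
perturb `f` to be constant on finitely many tiny intervals of nearly full total length, each sent to
an interior point of one of them. The dynamics on these intervals is then a self-map of a finite
set, so every orbit starting there ends in a cycle. -/

/-! ### Weak-* convergence and the distance `weakDist` -/

lemma integrable_continuous (φ : C(I, ℝ)) (μ : Measure I) [IsFiniteMeasure μ] :
    Integrable φ μ :=
  φ.continuous.integrable_of_hasCompactSupport (HasCompactSupport.of_compactSpace _)

lemma tendsto_iff_integral {ι : Type*} {l : Filter ι} {μs : ι → ProbabilityMeasure I}
    {μ : ProbabilityMeasure I} :
    Tendsto μs l (𝓝 μ) ↔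
      ∀ φ : C(I, ℝ), Tendsto (fun i => ∫ x, φ x ∂(μs i : Measure I)) l
        (𝓝 (∫ x, φ x ∂(μ : Measure I))) := by
  rw [ProbabilityMeasure.tendsto_iff_forall_integral_tendsto]
  exact ⟨fun h φ => h (BoundedContinuousFunction.mkOfCompact φ), fun h φ => h φ.toContinuousMap⟩

lemma ext_integral {μ ν : ProbabilityMeasure I}
    (h : ∀ φ : C(I, ℝ), ∫ x, φ x ∂(μ : Measure I) = ∫ x, φ x ∂(ν : Measure I)) : μ = ν := by
  have : Tendsto (fun _ : ℕ => μ) atTop (𝓝 ν) :=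
    tendsto_iff_integral.2 fun φ => by simp only [h φ]; exact tendsto_const_nhds
  exact tendsto_nhds_unique tendsto_const_nhds this

/-- A map into the unit interval as a real-valued map. -/
def toReal (ψ : C(I, I)) : C(I, ℝ) := ⟨fun x => (ψ x : ℝ), by fun_prop⟩

lemma integral_mem_Icc (ψ : C(I, I)) (μ : ProbabilityMeasure I) :
    ∫ x, (ψ x : ℝ) ∂(μ : Measure I) ∈ Icc (0 : ℝ) 1 := by
  refine ⟨integral_nonneg fun x => (ψ x).2.1, ?_⟩
  calc ∫ x, (ψ x : ℝ) ∂(μ : Measure I) ≤ ∫ _, (1 : ℝ) ∂(μ : Measure I) :=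
        integral_mono (integrable_continuous (toReal ψ) μ) (integrable_const _)
          fun x => (ψ x).2.2
    _ = 1 := by simp

lemma abs_integral_sub_integral_le_one (ψ : C(I, I)) (μ ν : ProbabilityMeasure I) :
    |(∫ x, (ψ x : ℝ) ∂(μ : Measure I)) - ∫ x, (ψ x : ℝ) ∂(ν : Measure I)| ≤ 1 := by
  have h1 := integral_mem_Icc ψ μ
  have h2 := integral_mem_Icc ψ ν
  rw [abs_le]; constructor <;> linarith [h1.1, h1.2, h2.1, h2.2]

lemma summable_half_pow_succ : Summable fun i : ℕ => (1 / 2 : ℝ) ^ (i + 1) :=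
  (summable_nat_add_iff 1).2 summable_geometric_two

lemma summable_weakDist (Ψ : ℕ → C(I, I)) (μ ν : ProbabilityMeasure I) :
    Summable fun i : ℕ => (1 / 2 : ℝ) ^ (i + 1) *
      |(∫ x, (Ψ i x : ℝ) ∂(μ : Measure I)) - ∫ x, (Ψ i x : ℝ) ∂(ν : Measure I)| :=
  Summable.of_nonneg_of_le (fun i => by positivity)
    (fun i => mul_le_of_le_one_right (by positivity) (abs_integral_sub_integral_le_one _ _ _))
    summable_half_pow_succ

lemma weakDist_triangle (Ψ : ℕ → C(I, I)) (μ ν ρ : ProbabilityMeasure I) :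
    weakDist Ψ μ ρ ≤ weakDist Ψ μ ν + weakDist Ψ ν ρ := by
  rw [weakDist, weakDist, weakDist,
    ← (summable_weakDist Ψ μ ν).tsum_add (summable_weakDist Ψ ν ρ)]
  refine (summable_weakDist Ψ μ ρ).tsum_le_tsum (fun i => ?_)
    ((summable_weakDist Ψ μ ν).add (summable_weakDist Ψ ν ρ))
  rw [← mul_add]
  exact mul_le_mul_of_nonneg_left (abs_sub_le _ _ _) (by positivity)

lemma weakDist_self (Ψ : ℕ → C(I, I)) (μ : ProbabilityMeasure I) : weakDist Ψ μ μ = 0 := by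
  simp [weakDist]

lemma tendsto_weakDist (Ψ : ℕ → C(I, I)) {μs : ℕ → ProbabilityMeasure I}
    {μ : ProbabilityMeasure I} (h : Tendsto μs atTop (𝓝 μ)) (ν : ProbabilityMeasure I) :
    Tendsto (fun n => weakDist Ψ (μs n) ν) atTop (𝓝 (weakDist Ψ μ ν)) := by
  refine tendsto_tsum_of_dominated_convergence summable_half_pow_succ (fun i => ?_)
    (Eventually.of_forall fun n i => ?_)
  · exact (((tendsto_iff_integral.1 h (toReal (Ψ i))).sub_const _).abs).const_mul _
  · rw [Real.norm_of_nonneg (by positivity)]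
    exact mul_le_of_le_one_right (by positivity) (abs_integral_sub_integral_le_one _ _ _)

lemma abs_integral_sub_le (μ : ProbabilityMeasure I) (φ ψ : C(I, ℝ)) {ε : ℝ}
    (h : ∀ x, |φ x - ψ x| ≤ ε) :
    |(∫ x, φ x ∂(μ : Measure I)) - ∫ x, ψ x ∂(μ : Measure I)| ≤ ε := by
  rw [← integral_sub (integrable_continuous φ μ) (integrable_continuous ψ μ)]
  have := norm_integral_le_of_norm_le_const (μ := (μ : Measure I)) (f := fun x => φ x - ψ x)
    (Eventually.of_forall fun x => by simpa using h x)
  simpa using this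

/-- Every term of the series vanishes. Density extends equality of integrals to all of `C(I, I)`,
and an affine rescaling extends it to real-valued continuous functions. -/
lemma eq_of_weakDist_eq_zero {Ψ : ℕ → C(I, I)} (hΨ : DenseRange Ψ) {μ ν : ProbabilityMeasure I}
    (h : weakDist Ψ μ ν = 0) : μ = ν := by
  have h1 : ∀ i, ∫ x, (Ψ i x : ℝ) ∂(μ : Measure I) = ∫ x, (Ψ i x : ℝ) ∂(ν : Measure I) := by
    intro i
    have := (summable_weakDist Ψ μ ν).le_tsum i (fun j _ => by positivity)
    rw [← weakDist, h] at this
    have h2 : (0 : ℝ) < (1 / 2 : ℝ) ^ (i + 1) := by positivity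
    exact sub_eq_zero.1 (abs_nonpos_iff.1 (nonpos_of_mul_nonpos_right this h2))
  have h2 : ∀ ψ : C(I, I),
      ∫ x, (ψ x : ℝ) ∂(μ : Measure I) = ∫ x, (ψ x : ℝ) ∂(ν : Measure I) := by
    intro ψ
    refine eq_of_forall_dist_le fun ε hε => ?_
    obtain ⟨i, hi⟩ := hΨ.exists_dist_lt ψ (half_pos hε)
    have hd : ∀ x, |toReal ψ x - toReal (Ψ i) x| ≤ ε / 2 := fun x =>
      (ContinuousMap.dist_apply_le_dist (f := ψ) (g := Ψ i) x).trans hi.le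
    have ha := abs_integral_sub_le μ _ _ hd
    have hb := abs_integral_sub_le ν _ _ hd
    have hc : ∫ x, toReal (Ψ i) x ∂(μ : Measure I) = ∫ x, toReal (Ψ i) x ∂(ν : Measure I) := h1 i
    change |(∫ x, toReal ψ x ∂(μ : Measure I)) - ∫ x, toReal ψ x ∂(ν : Measure I)| ≤ ε
    rw [abs_le] at *
    constructor <;> linarith [ha.1, ha.2, hb.1, hb.2]
  refine ext_integral fun φ => ?_
  set c : ℝ := ‖φ‖ + 1
  have hc : 0 < c := by positivity
  have hφ : ∀ x, |φ x| ≤ c := fun x => (φ.norm_coe_le_norm x).trans (by simp [c])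
  let ψ : C(I, I) := ⟨fun x => ⟨(φ x + c) / (2 * c), by
    have := abs_le.1 (hφ x)
    constructor
    · exact div_nonneg (by linarith) (by linarith)
    · rw [div_le_one (by linarith)]; linarith⟩, by fun_prop⟩
  have key : ∀ ρ : ProbabilityMeasure I, ∫ x, φ x ∂(ρ : Measure I) =
      2 * c * (∫ x, (ψ x : ℝ) ∂(ρ : Measure I)) - c := by
    intro ρ
    have : ∀ x, φ x = 2 * c * (ψ x : ℝ) - c := fun x => by
      change φ x = 2 * c * ((φ x + c) / (2 * c)) - c
      field_simp; ring
    simp_rw [this]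
    have hi : Integrable (fun x => 2 * c * (ψ x : ℝ)) (ρ : Measure I) :=
      (integrable_continuous (toReal ψ) ρ).const_mul _
    rw [integral_sub hi (integrable_const _), integral_const_mul]
    simp
  rw [key, key, h2]

lemma weakDist_nonneg (Ψ : ℕ → C(I, I)) (μ ν : ProbabilityMeasure I) : 0 ≤ weakDist Ψ μ ν :=
  tsum_nonneg fun i => by positivity

lemma weakDistSet_lt_iff {Ψ : ℕ → C(I, I)} {S : Set (ProbabilityMeasure I)}
    {μ : ProbabilityMeasure I} {ε : ℝ} (hε : 0 < ε) :
    weakDistSet Ψ S μ < ENNReal.ofReal ε ↔ ∃ ν ∈ S, weakDist Ψ ν μ < ε := by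
  simp [weakDistSet, iInf_lt_iff, ENNReal.ofReal_lt_ofReal_iff hε]

/-- By compactness every subsequence has a convergent further subsequence, whose limit is at
distance zero from `μ`. -/
lemma tendsto_of_weakDist {Ψ : ℕ → C(I, I)} (hΨ : DenseRange Ψ) {μs : ℕ → ProbabilityMeasure I}
    {μ : ProbabilityMeasure I} (h : Tendsto (fun n => weakDist Ψ (μs n) μ) atTop (𝓝 0)) :
    Tendsto μs atTop (𝓝 μ) := by
  refine tendsto_of_subseq_tendsto fun ns hns => ?_
  obtain ⟨ν, -, φ, hφ, hν⟩ := isCompact_univ.tendsto_subseq (x := fun n => μs (ns n))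
    fun n => mem_univ _
  refine ⟨φ, ?_⟩
  have h1 := tendsto_weakDist Ψ hν μ
  have h2 := h.comp (hns.comp hφ.tendsto_atTop)
  have h3 : weakDist Ψ ν μ = 0 := tendsto_nhds_unique h1 h2
  rw [← eq_of_weakDist_eq_zero hΨ h3]
  exact hν

/-! ### Pseudo-physical measures and limits of empirical measures -/

lemma isClosed_pseudoPhysical (Ψ : ℕ → C(I, I)) (f : C(I, I)) :
    IsClosed (pseudoPhysical Ψ f) := by
  rw [← closure_subset_iff_isClosed]
  intro μ hμ ε hε
  obtain ⟨μs, hm, hμs⟩ := mem_closure_iff_seq_limit.1 hμ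
  have h1 := tendsto_weakDist Ψ hμs μ
  rw [weakDist_self] at h1
  obtain ⟨n, hn⟩ := (h1.eventually_lt_const (half_pos hε)).exists
  refine (hm n (ε / 2) (half_pos hε)).trans_le (measure_mono fun x hx => ?_)
  obtain ⟨ν, hν, hd⟩ := (weakDistSet_lt_iff (half_pos hε)).1 hx
  refine (weakDistSet_lt_iff hε).2 ⟨ν, hν, ?_⟩
  linarith [weakDist_triangle Ψ ν (μs n) μ]

lemma pOmega_nonempty (f : C(I, I)) (x : I) : (pOmega f x).Nonempty := by
  obtain ⟨ν, -, φ, hφ, hν⟩ := isCompact_univ.tendsto_subseq (x := empirical f x)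
    fun n => mem_univ _
  exact ⟨ν, φ, hφ, hν⟩

lemma tendsto_empirical_of_pOmega_subset {f : C(I, I)} {x : I} {μ : ProbabilityMeasure I}
    (h : pOmega f x ⊆ {μ}) : Tendsto (empirical f x) atTop (𝓝 μ) := by
  refine tendsto_of_subseq_tendsto fun ns hns => ?_
  obtain ⟨φ, hφ, hnφ⟩ := strictMono_subseq_of_tendsto_atTop hns
  obtain ⟨ν, -, θ, hθ, hν⟩ := isCompact_univ.tendsto_subseq
    (x := fun n => empirical f x (ns (φ n))) fun n => mem_univ _
  have : ν = μ := h ⟨_, hnφ.comp hθ, hν⟩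
  exact ⟨φ ∘ θ, this ▸ hν⟩

lemma limitMeasure_eq {f : C(I, I)} {x : I} {μ : ProbabilityMeasure I}
    (h : Tendsto (empirical f x) atTop (𝓝 μ)) : limitMeasure f x = μ :=
  h.limUnder_eq

lemma pOmega_eq {f : C(I, I)} {x : I} {μ : ProbabilityMeasure I}
    (h : Tendsto (empirical f x) atTop (𝓝 μ)) : pOmega f x = {μ} := by
  ext ν
  constructor
  · rintro ⟨φ, hφ, hν⟩
    exact tendsto_nhds_unique hν (h.comp hφ.tendsto_atTop)
  · rintro rfl
    exact ⟨id, strictMono_id, h⟩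

lemma integral_empirical (f : C(I, I)) (x : I) (n : ℕ) (φ : C(I, ℝ)) :
    ∫ y, φ y ∂(empirical f x n : Measure I) =
      ((n : ℝ) + 1)⁻¹ * ∑ j ∈ Finset.range (n + 1), φ (f^[j] x) := by
  change ∫ y, φ y ∂(((n + 1 : ℕ) : ℝ≥0∞)⁻¹ •
    ∑ j ∈ Finset.range (n + 1), Measure.dirac (f^[j] x)) = _
  rw [integral_smul_measure, integral_finsetSum_measure fun i _ => integrable_continuous φ _]
  simp [integral_dirac]
  left
  norm_cast

lemma mem_invariantMeasures_iff {f : C(I, I)} {μ : ProbabilityMeasure I} :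
    μ ∈ invariantMeasures f ↔
      ∀ φ : C(I, ℝ), ∫ x, φ (f x) ∂(μ : Measure I) = ∫ x, φ x ∂(μ : Measure I) := by
  constructor
  · intro h φ
    have h1 : MeasurePreserving f (μ : Measure I) (μ : Measure I) := h
    conv_rhs => rw [← h1.map_eq]
    rw [integral_map f.continuous.aemeasurable φ.continuous.aestronglyMeasurable]
  · intro h
    refine ⟨f.continuous.measurable, ?_⟩
    have : μ.map f.continuous.aemeasurable = μ := ext_integral fun φ => by
      rw [← h φ]
      exact integral_map f.continuous.aemeasurable φ.continuous.aestronglyMeasurable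
    exact congrArg Subtype.val this

lemma pOmega_subset_invariantMeasures (f : C(I, I)) (x : I) :
    pOmega f x ⊆ invariantMeasures f := by
  rintro μ ⟨ns, hns, hμ⟩
  refine mem_invariantMeasures_iff.2 fun φ => ?_
  have h1 := tendsto_iff_integral.1 hμ (φ.comp f)
  have h2 := tendsto_iff_integral.1 hμ φ
  have h3 : Tendsto (fun n : ℕ => (2 * ‖φ‖) * ((n : ℝ) + 1)⁻¹) atTop (𝓝 0) := by
    simpa using (tendsto_one_div_add_atTop_nhds_zero_nat (𝕜 := ℝ)).const_mul (2 * ‖φ‖)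
  refine sub_eq_zero.1 (tendsto_nhds_unique (h1.sub h2)
    (squeeze_zero_norm (fun k => ?_) (h3.comp hns.tendsto_atTop)))
  rw [integral_empirical, integral_empirical, ← mul_sub, ← Finset.sum_sub_distrib]
  simp only [ContinuousMap.comp_apply, ← Function.iterate_succ_apply']
  -- The difference of the two Birkhoff sums telescopes to two boundary terms.
  rw [Finset.sum_range_sub (fun j => φ (f^[j] x)), norm_mul, mul_comm, Function.comp]
  rw [Real.norm_of_nonneg (r := ((ns k : ℝ) + 1)⁻¹) (by positivity)]
  refine mul_le_mul_of_nonneg_right ?_ (by positivity)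
  have ha := φ.norm_coe_le_norm (f^[ns k + 1] x)
  have hb := φ.norm_coe_le_norm (f^[0] x)
  linarith [norm_sub_le (φ (f^[ns k + 1] x)) (φ (f^[0] x))]

lemma empirical_apply_ge {f : C(I, I)} {x : I} {A : Set I} (hA : MeasurableSet A) {N : ℕ}
    (h : ∀ n ≥ N, f^[n] x ∈ A) (n : ℕ) :
    1 - (N : ℝ≥0∞) * ((n + 1 : ℕ) : ℝ≥0∞)⁻¹ ≤ (empirical f x n : Measure I) A := by
  have h1 : (empirical f x n : Measure I) Aᶜ ≤ (N : ℝ≥0∞) * ((n + 1 : ℕ) : ℝ≥0∞)⁻¹ := by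
    change (((n + 1 : ℕ) : ℝ≥0∞)⁻¹ •
      ∑ j ∈ Finset.range (n + 1), Measure.dirac (f^[j] x)) Aᶜ ≤ _
    rw [Measure.smul_apply, Measure.finsetSum_apply, smul_eq_mul, mul_comm]
    refine mul_le_mul_left ?_ _
    calc ∑ j ∈ Finset.range (n + 1), Measure.dirac (f^[j] x) Aᶜ
        ≤ ∑ j ∈ Finset.range (n + 1), if j ∈ Finset.range N then 1 else 0 := by
          refine Finset.sum_le_sum fun j _ => ?_
          split_ifs with hj
          · exact prob_le_one
          · rw [Measure.dirac_apply' _ hA.compl, indicator_of_notMem]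
            simpa using h j (by simpa using hj)
      _ ≤ N := by
          rw [← Finset.sum_filter, Finset.sum_const, nsmul_eq_mul, mul_one]
          norm_cast
          refine (Finset.card_le_card (t := Finset.range N) fun j hj => ?_).trans (by simp)
          exact (Finset.mem_filter.1 hj).2
  rw [tsub_le_iff_right, ← prob_add_prob_compl hA (μ := (empirical f x n : Measure I))]
  gcongr

/-- At most `N` points of the orbit lie outside `A`, so the empirical mass of `A` tends to 1.
Closedness lets the mass pass to the weak-* limit. -/
lemma measure_eq_one_of_mem_pOmega {f : C(I, I)} {x : I} {A : Set I} (hA : IsClosed A) {N : ℕ}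
    (h : ∀ n ≥ N, f^[n] x ∈ A) {ν : ProbabilityMeasure I} (hν : ν ∈ pOmega f x) :
    (ν : Measure I) A = 1 := by
  obtain ⟨ns, hns, hlim⟩ := hν
  refine le_antisymm prob_le_one ?_
  refine le_trans ?_ (ProbabilityMeasure.limsup_measure_closed_le_of_tendsto hlim hA)
  have h1 : Tendsto (fun n : ℕ => 1 - (N : ℝ≥0∞) * ((n + 1 : ℕ) : ℝ≥0∞)⁻¹) atTop (𝓝 1) := by
    have h2 : Tendsto (fun n : ℕ => (N : ℝ≥0∞) * ((n + 1 : ℕ) : ℝ≥0∞)⁻¹) atTop (𝓝 0) := by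
      have := (ENNReal.tendsto_inv_nat_nhds_zero.comp (tendsto_add_atTop_nat 1))
      simpa using ENNReal.Tendsto.const_mul this (Or.inr (ENNReal.natCast_ne_top N))
    simpa using ENNReal.Tendsto.sub tendsto_const_nhds h2 (Or.inl ENNReal.one_ne_top)
  rw [← (h1.comp hns.tendsto_atTop).limsup_eq]
  exact limsup_le_limsup (Eventually.of_forall fun k =>
    empirical_apply_ge hA.measurableSet h (ns k))

/-! ### Invariant measures carried by the cycle of a shrinking interval -/

lemma ediam_le_volume {s : Set I} (hs : s.OrdConnected) :
    Metric.ediam s ≤ (volume : Measure I) s := by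
  refine Metric.ediam_le fun x hx y hy => ?_
  rw [← unitInterval.volume_uIcc]
  exact measure_mono (hs.uIcc_subset hy hx)

section PeriodicShrinking

variable {f : C(I, I)} {p : ℕ} {J : Set I}

/-- The image of `J` is an interval, so its measure bounds its diameter, and taking closures does
not increase the diameter. -/
lemma IsPeriodicShrinking.ediam_image_le (h : IsPeriodicShrinking f p J) {j : ℕ} (hj : j < p) :
    Metric.ediam (f^[j] '' closure J) ≤ (volume : Measure I) J := by
  obtain ⟨a, b, hab, hJ⟩ := h.isOpenInterval
  have hf : Continuous f^[j] := f.continuous.iterate j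
  have hc : (f^[j] '' J).OrdConnected := by
    rw [hJ]; exact (isPreconnected_Ioo.image _ hf.continuousOn).ordConnected
  calc Metric.ediam (f^[j] '' closure J) ≤ Metric.ediam (closure (f^[j] '' J)) :=
        Metric.ediam_mono (image_closure_subset_closure_image hf)
    _ = Metric.ediam (f^[j] '' J) := Metric.ediam_closure _
    _ ≤ (volume : Measure I) (f^[j] '' J) := ediam_le_volume hc
    _ ≤ (volume : Measure I) J := by
        rcases Nat.eq_zero_or_pos j with rfl | h0
        · simp
        · exact (h.length_lt j h0 hj).le

lemma IsPeriodicShrinking.mapsTo (h : IsPeriodicShrinking f p J) :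
    MapsTo f^[p] (closure J) (closure J) := fun _ hx =>
  subset_closure (h.image_subset (mem_image_of_mem _ hx))

lemma IsPeriodicShrinking.iterate_mem (h : IsPeriodicShrinking f p J) {y : I}
    (hy : y ∈ closure J) (n : ℕ) : f^[n] y ∈ f^[n % p] '' closure J := by
  refine ⟨(f^[p])^[n / p] y, h.mapsTo.iterate _ hy, ?_⟩
  rw [← Function.iterate_mul, ← Function.iterate_add_apply, Nat.mod_add_div]

/-- The cycle of images of the closure of `J`. -/
def cycle (f : C(I, I)) (p : ℕ) (J : Set I) : Set I :=
  ⋃ j ∈ Finset.Icc 1 p, f^[j] '' closure J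

lemma isClosed_cycle : IsClosed (cycle f p J) :=
  isClosed_biUnion_finset fun j _ =>
    (isClosed_closure.isCompact.image (f.continuous.iterate j)).isClosed

lemma IsPeriodicShrinking.iterate_mem_cycle (h : IsPeriodicShrinking f p J) {y : I}
    (hy : y ∈ closure J) {n : ℕ} (hn : 1 ≤ n) : f^[n] y ∈ cycle f p J := by
  obtain ⟨m, rfl⟩ := Nat.exists_eq_add_of_le' hn
  obtain ⟨z, hz, hzm⟩ := h.iterate_mem hy m
  refine mem_biUnion (x := m % p + 1) ?_ ⟨z, hz, ?_⟩
  · have := Nat.mod_lt m h.one_le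
    simp only [Finset.coe_Icc, mem_Icc]; lia
  · rw [Function.iterate_succ_apply', hzm, Function.iterate_succ_apply']

lemma sum_range_periodic_shift {u : ℕ → ℝ} (hu : ∀ i, u (i + p) = u i) (l : ℕ) :
    ∑ i ∈ Finset.range p, u (i + l) = ∑ i ∈ Finset.range p, u i := by
  induction l with
  | zero => simp
  | succ l ih =>
    have h1 := Finset.sum_range_succ' (fun i => u (i + l)) p
    have h2 := Finset.sum_range_succ (fun i => u (i + l)) p
    rw [h2] at h1
    simp only [zero_add, add_comm p l, hu] at h1
    rw [← ih]
    simp only [← add_assoc, add_right_comm _ l 1]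
    linarith

/-- A point `z` of the `l`-th piece visits the pieces in the same cyclic order as `y₀`, shifted by
`l`. After rotating the sum for `y₀`, the paired points share a piece, whose diameter is at most the
length of `J`. -/
lemma IsPeriodicShrinking.abs_sum_sub_le (h : IsPeriodicShrinking f p J) {φ : C(I, ℝ)} {ε : ℝ}
    (hφ : ∀ x y, edist x y ≤ (volume : Measure I) J → |φ x - φ y| ≤ ε) {y₀ z : I}
    (hy₀ : y₀ ∈ closure J) (hz : z ∈ cycle f p J) :
    |∑ i ∈ Finset.range p, φ (f^[i] z) - ∑ i ∈ Finset.range p, φ (f^[i] y₀)| ≤ p * ε := by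
  obtain ⟨l, -, y, hy, rfl⟩ := by simpa only [cycle, mem_iUnion] using hz
  rw [show ∑ i ∈ Finset.range p, φ (f^[i] y₀) = ∑ i ∈ Finset.range p, φ (f^[(i + l) % p] y₀) by
      rw [sum_range_periodic_shift (u := fun i => φ (f^[i % p] y₀)) (by simp)]
      exact Finset.sum_congr rfl fun i hi => by rw [Nat.mod_eq_of_lt (Finset.mem_range.1 hi)],
    ← Finset.sum_sub_distrib]
  refine (Finset.abs_sum_le_sum_abs _ _).trans ?_
  refine (Finset.sum_le_card_nsmul _ _ ε fun i _ => ?_).trans (by simp)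
  rw [← Function.iterate_add_apply]
  refine hφ _ _ (le_trans ?_ (h.ediam_image_le (Nat.mod_lt (i + l) h.one_le)))
  exact Metric.edist_le_ediam_of_mem (h.iterate_mem hy _) (mem_image_of_mem _ hy₀)

lemma integral_iterate {μ : ProbabilityMeasure I} (hμ : μ ∈ invariantMeasures f) (φ : C(I, ℝ))
    (n : ℕ) : ∫ x, φ (f^[n] x) ∂(μ : Measure I) = ∫ x, φ x ∂(μ : Measure I) := by
  induction n with
  | zero => simp
  | succ n ih =>
    rw [← ih]
    exact mem_invariantMeasures_iff.1 hμ (φ.comp ⟨f^[n], f.continuous.iterate n⟩)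

/-- By invariance, `∫ φ dμ` is the integral of the Birkhoff average over one period, which is nearly
constant on the cycle. The comparison value does not depend on `μ`. -/
lemma IsPeriodicShrinking.abs_integral_sub_le (h : IsPeriodicShrinking f p J) {φ : C(I, ℝ)}
    {ε : ℝ} (hφ : ∀ x y, edist x y ≤ (volume : Measure I) J → |φ x - φ y| ≤ ε)
    {μ : ProbabilityMeasure I} (hμ : μ ∈ invariantMeasures f)
    (h1 : (μ : Measure I) (cycle f p J) = 1) {y₀ : I} (hy₀ : y₀ ∈ closure J) :
    |(∫ x, φ x ∂(μ : Measure I)) - (p : ℝ)⁻¹ * ∑ i ∈ Finset.range p, φ (f^[i] y₀)| ≤ ε := by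
  have hp : (0 : ℝ) < p := by exact_mod_cast h.one_le
  have hint : ∀ i, Integrable (fun x => φ (f^[i] x)) (μ : Measure I) := fun i =>
    integrable_continuous (φ.comp ⟨f^[i], f.continuous.iterate i⟩) μ
  have hS : ∫ z, (∑ i ∈ Finset.range p, φ (f^[i] z)) ∂(μ : Measure I) =
      p * ∫ x, φ x ∂(μ : Measure I) := by
    rw [integral_finsetSum _ fun i _ => hint i]
    simp [integral_iterate hμ]
  have hae : ∀ᵐ z ∂(μ : Measure I), z ∈ cycle f p J :=
    (prob_compl_eq_zero_iff isClosed_cycle.measurableSet).2 h1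
  have hb := norm_integral_le_of_norm_le_const (μ := (μ : Measure I))
    (f := fun z => ∑ i ∈ Finset.range p, φ (f^[i] z) - ∑ i ∈ Finset.range p, φ (f^[i] y₀))
    (C := p * ε) (hae.mono fun z hz => h.abs_sum_sub_le hφ hy₀ hz)
  rw [integral_sub (integrable_finsetSum _ fun i _ => hint i) (integrable_const _), hS] at hb
  simp only [integral_const, probReal_univ, one_smul, mul_one, Real.norm_eq_abs] at hb
  rw [← mul_le_mul_iff_right₀ hp, ← abs_of_pos hp, ← abs_mul, mul_sub, abs_of_pos hp,
    mul_inv_cancel_left₀ hp.ne']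
  exact hb

end PeriodicShrinking

/-! ### Cycles of length tending to zero and the deterministic conclusion -/

lemma exists_osc_le (φ : C(I, ℝ)) {ε : ℝ} (hε : 0 < ε) : ∃ N : ℕ, ∀ q ≥ N, ∀ x y : I,
    edist x y ≤ 1 / (q : ℝ≥0∞) → |φ x - φ y| ≤ ε := by
  obtain ⟨δ, hδ, h⟩ := Metric.uniformContinuous_iff.1
    (CompactSpace.uniformContinuous_of_continuous φ.continuous) ε hε
  obtain ⟨N, hN⟩ := exists_nat_gt (1 / δ)
  have hN0 : (0 : ℝ) < N := (one_div_pos.2 hδ).trans hN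
  refine ⟨N, fun q hq x y hxy => (h ?_).le⟩
  have hq0 : (0 : ℝ) < q := hN0.trans_le (by exact_mod_cast hq)
  rw [edist_dist, ← ENNReal.ofReal_one, ← ENNReal.ofReal_natCast,
    ← ENNReal.ofReal_div_of_pos hq0, ENNReal.ofReal_le_ofReal_iff (by positivity)] at hxy
  refine hxy.trans_lt ?_
  rw [div_lt_comm₀ hq0 hδ]
  exact hN.trans_le (by exact_mod_cast hq)

/-- If the invariant measures `ν q` and `μ` are carried by cycles of the periodic shrinking
intervals `J q` whose lengths tend to `0`, then `ν q` tends to `μ`. -/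
lemma tendsto_of_cycles {f : C(I, I)} {J : ℕ → Set I} {p : ℕ → ℕ}
    (hJ : ∀ q, 1 ≤ q → IsPeriodicShrinking f (p q) (J q))
    (hv : ∀ q, 1 ≤ q → (volume : Measure I) (J q) < 1 / (q : ℝ≥0∞))
    {μ : ProbabilityMeasure I} {ν : ℕ → ProbabilityMeasure I} (hμ : μ ∈ invariantMeasures f)
    (hν : ∀ q, 1 ≤ q → ν q ∈ invariantMeasures f)
    (hμ1 : ∀ q, 1 ≤ q → (μ : Measure I) (cycle f (p q) (J q)) = 1)
    (hν1 : ∀ q, 1 ≤ q → (ν q : Measure I) (cycle f (p q) (J q)) = 1) :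
    Tendsto ν atTop (𝓝 μ) := by
  refine tendsto_iff_integral.2 fun φ => Metric.tendsto_atTop.2 fun ε hε => ?_
  obtain ⟨N, hN⟩ := exists_osc_le φ (ε := ε / 3) (by linarith)
  refine ⟨max N 1, fun q hq => ?_⟩
  have hq1 := (le_max_right N 1).trans hq
  have hφ : ∀ x y, edist x y ≤ (volume : Measure I) (J q) → |φ x - φ y| ≤ ε / 3 :=
    fun x y hxy => hN q ((le_max_left N 1).trans hq) x y (hxy.trans (hv q hq1).le)
  obtain ⟨a, b, hab, hJab⟩ := (hJ q hq1).isOpenInterval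
  obtain ⟨y₀, hy₀⟩ : (J q).Nonempty := hJab ▸ nonempty_Ioo.2 hab
  have ha := (hJ q hq1).abs_integral_sub_le hφ hμ (hμ1 q hq1) (subset_closure hy₀)
  have hb := (hJ q hq1).abs_integral_sub_le hφ (hν q hq1) (hν1 q hq1) (subset_closure hy₀)
  rw [Real.dist_eq, abs_lt]
  rw [abs_le] at ha hb
  constructor <;> linarith [ha.1, ha.2, hb.1, hb.2]

lemma measure_cycle_eq_one {f : C(I, I)} {p : ℕ} {J : Set I} (hJ : IsPeriodicShrinking f p J)
    {x : I} {n : ℕ} (hx : f^[n] x ∈ J) {ν : ProbabilityMeasure I} (hν : ν ∈ pOmega f x) :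
    (ν : Measure I) (cycle f p J) = 1 := by
  refine measure_eq_one_of_mem_pOmega isClosed_cycle (N := n + 1) (fun m hm => ?_) hν
  obtain ⟨k, rfl⟩ := Nat.exists_eq_add_of_le' hm
  rw [show k + (n + 1) = (k + 1) + n by lia, Function.iterate_add_apply]
  exact hJ.iterate_mem_cycle (subset_closure hx) (by lia)

/-- It suffices that one `J q`, of positive length, consists of good points. Otherwise bad points
chosen in each `J q` yield limit measures carried by the cycles yet staying `ε`-far from `μ`,
against `tendsto_of_cycles`. -/
lemma infinitelyShrinked_subset_pseudoPhysical (Ψ : ℕ → C(I, I)) (f : C(I, I)) :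
    infinitelyShrinked f ⊆ pseudoPhysical Ψ f := by
  rintro μ ⟨hμ, J, p, h⟩ ε hε
  suffices ∃ q, 1 ≤ q ∧ ∀ x ∈ J q, weakDistSet Ψ (pOmega f x) μ < ENNReal.ofReal ε by
    obtain ⟨q, hq, hx⟩ := this
    refine lt_of_lt_of_le ?_ (measure_mono hx)
    obtain ⟨a, b, hab, hJab⟩ := (h q hq).1.isOpenInterval
    rw [hJab, unitInterval.volume_Ioo]
    exact ENNReal.ofReal_pos.2 (sub_pos.2 hab)
  by_contra! hcon
  have hex : ∀ q : ℕ, ∃ ν : ProbabilityMeasure I, 1 ≤ q →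
      ν ∈ invariantMeasures f ∧ (ν : Measure I) (cycle f (p q) (J q)) = 1 ∧
      ε ≤ weakDist Ψ ν μ := by
    intro q
    by_cases hq : 1 ≤ q
    · obtain ⟨x, hx, hd⟩ := hcon q hq
      obtain ⟨ν, hν⟩ := pOmega_nonempty f x
      refine ⟨ν, fun _ => ⟨pOmega_subset_invariantMeasures f x hν,
        measure_cycle_eq_one (h q hq).1 (n := 0) hx hν, ?_⟩⟩
      by_contra! hlt
      exact hd.not_gt ((weakDistSet_lt_iff hε).2 ⟨ν, hν, hlt⟩)
    · exact ⟨μ, fun h => absurd h hq⟩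
  choose ν hν using hex
  have ht := tendsto_of_cycles (fun q hq => (h q hq).1) (fun q hq => (h q hq).2.1) hμ
    (fun q hq => (hν q hq).1) (fun q hq => (h q hq).2.2) (fun q hq => (hν q hq).2.1)
  have h0 := tendsto_weakDist Ψ ht μ
  rw [weakDist_self] at h0
  have := ge_of_tendsto h0 (eventually_atTop.2 ⟨1, fun q hq => (hν q hq).2.2⟩)
  linarith

lemma exists_tendsto_infinitelyShrinked {f : C(I, I)} {x : I}
    (h : ∀ q : ℕ, 1 ≤ q → ∃ p J, IsPeriodicShrinking f p J ∧
      (volume : Measure I) J < 1 / (q : ℝ≥0∞) ∧ ∃ n, f^[n] x ∈ J) :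
    ∃ μ ∈ infinitelyShrinked f, Tendsto (empirical f x) atTop (𝓝 μ) := by
  have h' : ∀ q : ℕ, ∃ p J, 1 ≤ q → IsPeriodicShrinking f p J ∧
      (volume : Measure I) J < 1 / (q : ℝ≥0∞) ∧ ∃ n, f^[n] x ∈ J := by
    intro q
    by_cases hq : 1 ≤ q
    · obtain ⟨p, J, h⟩ := h q hq
      exact ⟨p, J, fun _ => h⟩
    · exact ⟨0, ∅, fun h => absurd h hq⟩
  choose p J hpJ using h'
  have h1 : ∀ ν ∈ pOmega f x, ∀ q, 1 ≤ q → (ν : Measure I) (cycle f (p q) (J q)) = 1 := by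
    intro ν hν q hq
    obtain ⟨n, hn⟩ := (hpJ q hq).2.2
    exact measure_cycle_eq_one (hpJ q hq).1 hn hν
  have hinv := pOmega_subset_invariantMeasures f x
  obtain ⟨μ, hμ⟩ := pOmega_nonempty f x
  refine ⟨μ, ⟨hinv hμ, J, p, fun q hq => ⟨(hpJ q hq).1, (hpJ q hq).2.1, h1 μ hμ q hq⟩⟩,
    tendsto_empirical_of_pOmega_subset fun ν hν => ?_⟩
  exact tendsto_nhds_unique tendsto_const_nhds (tendsto_of_cycles (ν := fun _ => ν)
    (fun q hq => (hpJ q hq).1) (fun q hq => (hpJ q hq).2.1) (hinv hμ) (fun _ _ => hinv hν)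
    (h1 μ hμ) (h1 ν hν))

/-- The deterministic part of the theorem: everything follows once almost every orbit enters
arbitrarily short periodic shrinking intervals. -/
lemma conclusion_of_ae {Ψ : ℕ → C(I, I)} (hΨ : DenseRange Ψ) {f : C(I, I)}
    (h : ∀ᵐ x ∂(volume : Measure I), ∀ q : ℕ, 1 ≤ q → ∃ p J, IsPeriodicShrinking f p J ∧
      (volume : Measure I) J < 1 / (q : ℝ≥0∞) ∧ ∃ n, f^[n] x ∈ J) :
    (NullMeasurableSet (AA₂ Ψ f) (volume : Measure I) ∧ (volume : Measure I) (AA₂ Ψ f) = 1) ∧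
      pseudoPhysical Ψ f = closure (limitMeasure f '' AA₂ Ψ f) ∧
      closure (limitMeasure f '' AA₂ Ψ f) = closure (infinitelyShrinked f) := by
  have hae : ∀ᵐ x ∂(volume : Measure I), x ∈ AA₂ Ψ f := h.mono fun x hx => by
    obtain ⟨μ, hμ, hlim⟩ := exists_tendsto_infinitelyShrinked hx
    have heq := limitMeasure_eq hlim
    exact ⟨⟨⟨⟨μ, hlim⟩, heq.symm ▸ pOmega_eq hlim⟩,
      heq.symm ▸ infinitelyShrinked_subset_pseudoPhysical Ψ f hμ⟩, heq.symm ▸ hμ⟩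
  have hsub1 : limitMeasure f '' AA₂ Ψ f ⊆ infinitelyShrinked f := by
    rintro _ ⟨x, hx, rfl⟩; exact hx.2
  have hsub2 : closure (infinitelyShrinked f) ⊆ pseudoPhysical Ψ f :=
    closure_minimal (infinitelyShrinked_subset_pseudoPhysical Ψ f) (isClosed_pseudoPhysical Ψ f)
  have hsub3 : pseudoPhysical Ψ f ⊆ closure (limitMeasure f '' AA₂ Ψ f) := by
    intro μ hμ
    have hex : ∀ n : ℕ, ∃ x ∈ AA₂ Ψ f, weakDist Ψ (limitMeasure f x) μ < 1 / ((n : ℝ) + 1) := by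
      intro n
      have hn : (0 : ℝ) < 1 / ((n : ℝ) + 1) := by positivity
      obtain ⟨x, hx, hx2⟩ := ((frequently_ae_iff.2 (hμ _ hn).ne').and_eventually hae).exists
      obtain ⟨ν, hν, hd⟩ := (weakDistSet_lt_iff hn).1 hx
      -- Since `pω(x)` is a singleton here, the nearby limit measure is `μ_x` itself.
      rw [hx2.1.1.2] at hν
      exact ⟨x, hx2, hν ▸ hd⟩
    choose x hx hd using hex
    exact mem_closure_of_tendsto (tendsto_of_weakDist hΨ
      (squeeze_zero (fun n => weakDist_nonneg _ _ _) (fun n => (hd n).le)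
        tendsto_one_div_add_atTop_nhds_zero_nat))
      (Eventually.of_forall fun n => mem_image_of_mem _ (hx n))
  have hsub4 := closure_mono hsub1
  have huniv : AA₂ Ψ f =ᵐ[volume] (univ : Set I) := eventuallyEq_univ.2 hae
  refine ⟨⟨nullMeasurableSet_univ.congr huniv.symm, ?_⟩, hsub3.antisymm (hsub4.trans hsub2),
    hsub4.antisymm (hsub2.trans hsub3)⟩
  rw [measure_congr huniv, measure_univ]

/-! ### Openness of the capture condition -/

/-- A version of `IsPeriodicShrinking f p (Ioo a b)` that is an open condition on `f`. -/
structure IsRobustlyShrinking (f : C(I, I)) (p : ℕ) (a b : I) : Prop where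
  one_le : 1 ≤ p
  lt : a < b
  disjoint_images : ∀ i < p, ∀ j < p, i ≠ j →
    Disjoint (f^[i] '' closure (Ioo a b)) (f^[j] '' closure (Ioo a b))
  mapsTo : MapsTo f^[p] (closure (Ioo a b)) (Ioo a b)
  volume_lt : ∀ j < p, 1 ≤ j →
    (volume : Measure I) (f^[j] '' closure (Ioo a b)) < (volume : Measure I) (Ioo a b)

lemma IsRobustlyShrinking.isPeriodicShrinking {f : C(I, I)} {p : ℕ} {a b : I}
    (h : IsRobustlyShrinking f p a b) : IsPeriodicShrinking f p (Ioo a b) where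
  one_le := h.one_le
  isOpenInterval := ⟨a, b, h.lt, rfl⟩
  disjoint_images := h.disjoint_images
  image_subset := h.mapsTo.image_subset
  length_lt j h1 hj := (measure_mono (image_mono subset_closure)).trans_lt (h.volume_lt j hj h1)

/-- The iterates of a continuous map, as continuous maps. -/
def iter (n : ℕ) (f : C(I, I)) : C(I, I) := ⟨f^[n], f.continuous.iterate n⟩

lemma continuous_iter (n : ℕ) : Continuous (iter n) := by
  induction n with
  | zero => exact continuous_const (y := ContinuousMap.id I)
  | succ n ih => exact ih.compCM continuous_id

lemma eventually_mapsTo {f : C(I, I)} {n : ℕ} {K U : Set I} (hK : IsCompact K) (hU : IsOpen U)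
    (h : MapsTo f^[n] K U) : ∀ᶠ g : C(I, I) in 𝓝 f, MapsTo g^[n] K U :=
  (continuous_iter n).continuousAt.eventually (ContinuousMap.eventually_mapsTo hK hU h)

lemma eventually_disjoint_image {f : C(I, I)} {i j : ℕ} {K : Set I} (hK : IsCompact K)
    (h : Disjoint (f^[i] '' K) (f^[j] '' K)) :
    ∀ᶠ g : C(I, I) in 𝓝 f, Disjoint (g^[i] '' K) (g^[j] '' K) := by
  obtain ⟨U, V, hU, hV, hiU, hjV, hUV⟩ := SeparatedNhds.of_isCompact_isCompact
    (hK.image (f.continuous.iterate i)) (hK.image (f.continuous.iterate j)) h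
  filter_upwards [eventually_mapsTo hK hU (mapsTo_iff_image_subset.2 hiU),
    eventually_mapsTo hK hV (mapsTo_iff_image_subset.2 hjV)] with g h1 h2
  exact hUV.mono h1.image_subset h2.image_subset

lemma eventually_volume_image_lt {f : C(I, I)} {j : ℕ} {K : Set I} (hK : IsCompact K) {c : ℝ≥0∞}
    (h : (volume : Measure I) (f^[j] '' K) < c) :
    ∀ᶠ g : C(I, I) in 𝓝 f, (volume : Measure I) (g^[j] '' K) < c := by
  obtain ⟨U, hKU, hU, hc⟩ := Set.exists_isOpen_lt_of_lt _ _ h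
  filter_upwards [eventually_mapsTo hK hU (mapsTo_iff_image_subset.2 hKU)] with g hg
  exact (measure_mono hg.image_subset).trans_lt hc

lemma IsRobustlyShrinking.eventually {f : C(I, I)} {p : ℕ} {a b : I}
    (h : IsRobustlyShrinking f p a b) : ∀ᶠ g in 𝓝 f, IsRobustlyShrinking g p a b := by
  have hK : IsCompact (closure (Ioo a b)) := isClosed_closure.isCompact
  have h1 : ∀ᶠ g : C(I, I) in 𝓝 f, ∀ i < p, ∀ j < p, i ≠ j →
      Disjoint (g^[i] '' closure (Ioo a b)) (g^[j] '' closure (Ioo a b)) := by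
    refine (eventually_all_finite (finite_Iio p)).2 fun i hi =>
      (eventually_all_finite (finite_Iio p)).2 fun j hj => ?_
    by_cases hij : i = j
    · simp [hij]
    · exact (eventually_disjoint_image hK (h.disjoint_images i hi j hj hij)).mono fun _ h _ => h
  have h2 : ∀ᶠ g : C(I, I) in 𝓝 f, ∀ j < p, 1 ≤ j →
      (volume : Measure I) (g^[j] '' closure (Ioo a b)) < (volume : Measure I) (Ioo a b) := by
    refine (eventually_all_finite (finite_Iio p)).2 fun j hj => ?_
    by_cases h1j : 1 ≤ j
    · exact (eventually_volume_image_lt hK (h.volume_lt j hj h1j)).mono fun _ h _ => h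
    · simp [h1j]
  filter_upwards [h1, h2, eventually_mapsTo hK isOpen_Ioo h.mapsTo] with g h1 h2 h3
  exact ⟨h.one_le, h.lt, h1, h3, h2⟩

/-- The pairs `(f, x)` such that the orbit of `x` under `f` enters a robustly shrinking periodic
interval of length less than `c`. -/
def capture (c : ℝ≥0∞) : Set (C(I, I) × I) :=
  {z | ∃ p a b n, IsRobustlyShrinking z.1 p a b ∧ (volume : Measure I) (Ioo a b) < c ∧
    z.1^[n] z.2 ∈ Ioo a b}

lemma isOpen_capture (c : ℝ≥0∞) : IsOpen (capture c) := by
  refine isOpen_iff_mem_nhds.2 ?_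
  rintro ⟨f, x⟩ ⟨p, a, b, n, hr, hv, hn⟩
  have hcont : Continuous fun z : C(I, I) × I => z.1^[n] z.2 := by
    have : Continuous fun z : C(I, I) × I => iter n z.1 z.2 :=
      ((continuous_iter n).comp continuous_fst).eval continuous_snd
    exact this
  filter_upwards [continuousAt_fst.eventually hr.eventually,
    hcont.continuousAt.eventually (isOpen_Ioo.mem_nhds hn)] with z h1 h2
  exact ⟨p, a, b, n, h1, hv, h2⟩

/-- Inner regularity gives a compact subset of the section with measure still above `c`. By the tube
lemma it lies in all nearby sections. -/
lemma isOpen_setOf_lt_measure_section {X Y : Type*} [TopologicalSpace X] [TopologicalSpace Y]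
    [MeasurableSpace Y] (μ : Measure Y) [μ.InnerRegularCompactLTTop] [IsFiniteMeasure μ]
    [BorelSpace Y]
    {W : Set (X × Y)} (hW : IsOpen W) (c : ℝ≥0∞) : IsOpen {x | c < μ {y | (x, y) ∈ W}} := by
  refine isOpen_iff_mem_nhds.2 fun x hx => ?_
  have hO : IsOpen {y | (x, y) ∈ W} := hW.preimage (Continuous.prodMk_right x)
  obtain ⟨K, hKs, hK, hc⟩ := hO.measurableSet.exists_lt_isCompact_of_ne_top (measure_ne_top _ _) hx
  obtain ⟨u, v, hu, -, hxu, hKv, huv⟩ := generalized_tube_lemma (isCompact_singleton (x := x)) hK hW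
    (by rintro ⟨x', y⟩ ⟨rfl, hy⟩; exact hKs hy)
  filter_upwards [hu.mem_nhds (hxu rfl)] with z hz
  exact hc.trans_le (measure_mono fun y hy => huv ⟨hz, hKv hy⟩)

/-! ### Density by locally constant perturbation -/

/-- A map that is almost constant on each of finitely many disjoint closed sets is close to a map
that is constant on each of them. -/
lemma exists_locally_constant_near (f : C(I, I)) {ι : Type*} [Finite ι] {C : ι → Set I}
    (hC : ∀ i, IsClosed (C i)) (hd : Pairwise (Function.onFun Disjoint C)) (c : ι → I) {ρ : ℝ}
    (hρ : 0 ≤ ρ) (h : ∀ i, ∀ x ∈ C i, dist (c i) (f x) ≤ ρ) :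
    ∃ g : C(I, I), (∀ x, dist (g x) (f x) ≤ ρ) ∧ ∀ i, ∀ x ∈ C i, g x = c i := by
  classical
  let e : I → ℝ := fun x => if h : ∃ i, x ∈ C i then (c h.choose : ℝ) - f x else 0
  have he : ∀ i, ∀ x ∈ C i, e x = c i - f x := by
    intro i x hx
    have hex : ∃ i, x ∈ C i := ⟨i, hx⟩
    have : hex.choose = i := by
      by_contra hne
      exact (hd hne).le_bot ⟨hex.choose_spec, hx⟩
    simp only [e, dif_pos hex, this]
  have hcont : ContinuousOn e (⋃ i, C i) :=
    (locallyFinite_of_finite C).continuousOn_iUnion hC fun i =>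
      ContinuousOn.congr (f := fun x => (c i : ℝ) - f x) (by fun_prop) (he i)
  have hclosed : IsClosed (⋃ i, C i) := isClosed_iUnion_of_finite hC
  have : CompactSpace (⋃ i, C i) := isCompact_iff_compactSpace.1 hclosed.isCompact
  -- Tietze extension of the correction `e` with the same sup norm. The sum `f + G` is then
  -- retracted to `[0,1]` by a 1-Lipschitz projection.
  obtain ⟨G, hG, hGe⟩ := BoundedContinuousFunction.exists_norm_eq_domRestrict_eq_of_closed
    (BoundedContinuousFunction.mkOfCompact ⟨_, hcont.domRestrict⟩) hclosed
  have hGρ : ∀ x, |G x| ≤ ρ := by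
    intro x
    refine (G.norm_coe_le_norm x).trans (hG.trans_le ?_)
    refine (BoundedContinuousFunction.norm_le hρ).2 ?_
    rintro ⟨x, hx⟩
    obtain ⟨i, hi⟩ := mem_iUnion.1 hx
    change |e x| ≤ ρ
    rw [he i x hi]
    exact h i x hi
  refine ⟨⟨fun x => projIcc 0 1 zero_le_one ((f x : ℝ) + G x), by fun_prop⟩, fun x => ?_,
    fun i x hx => ?_⟩
  · change dist (projIcc 0 1 zero_le_one ((f x : ℝ) + G x)) (f x) ≤ ρ
    conv_lhs => rw [← projIcc_val zero_le_one (f x)]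
    refine ((LipschitzWith.projIcc zero_le_one).dist_le_mul _ _).trans ?_
    simpa [Real.dist_eq] using hGρ x
  · have hGx : G x = e x := DFunLike.congr_fun hGe ⟨x, mem_iUnion.2 ⟨i, hx⟩⟩
    change projIcc 0 1 zero_le_one ((f x : ℝ) + G x) = c i
    rw [hGx, he i x hx, add_sub_cancel, projIcc_val]

/-- If a map sends each of finitely many disjoint closed intervals to the marked point of one of them,
every orbit that starts in one of them is captured. -/
lemma mem_capture_of_constant_on_cells {g : C(I, I)} {ι : Type*} [Finite ι] {a b m : ι → I}
    (τ : ι → ι) (ham : ∀ i, a i < m i) (hmb : ∀ i, m i < b i)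
    (hd : Pairwise (Function.onFun Disjoint fun i => Icc (a i) (b i)))
    (hg : ∀ i, ∀ x ∈ Icc (a i) (b i), g x = m (τ i)) {c : ℝ≥0∞}
    (hc : ∀ i, (volume : Measure I) (Ioo (a i) (b i)) < c) {i : ι} {x : I}
    (hx : x ∈ Icc (a i) (b i)) : (g, x) ∈ capture c := by
  have hm : ∀ i, m i ∈ Ioo (a i) (b i) := fun i => ⟨ham i, hmb i⟩
  have hit : ∀ n i, ∀ x ∈ Icc (a i) (b i), g^[n + 1] x = m (τ^[n + 1] i) := by
    intro n
    induction n with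
    | zero => exact hg
    | succ n ih =>
      intro i x hx
      rw [Function.iterate_succ_apply, hg i x hx, ih _ _ (Ioo_subset_Icc_self (hm _)),
        ← Function.iterate_succ_apply]
  have hit' : ∀ n i, ∀ x ∈ Icc (a i) (b i),
      g^[n] x ∈ Icc (a (τ^[n] i)) (b (τ^[n] i)) := by
    rintro (_ | n) i x hx
    · exact hx
    · rw [hit n i x hx]; exact Ioo_subset_Icc_self (hm _)
  -- Pigeonhole on the finite index set. Starting at `n + 1` puts the orbit of `x` exactly at a
  -- marked point, inside the open interval.
  obtain ⟨n, k, hk, hper⟩ : ∃ n k, 0 < k ∧ τ^[k] (τ^[n + 1] i) = τ^[n + 1] i := by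
    obtain ⟨s, t, hst, h⟩ := Finite.exists_ne_map_eq_of_infinite fun n : ℕ => τ^[n + 1] i
    wlog hlt : s < t generalizing s t
    · exact this t s hst.symm h.symm (by lia)
    · refine ⟨s, t - s, by lia, ?_⟩
      rw [← Function.iterate_add_apply, show t - s + (s + 1) = t + 1 by lia]
      exact h.symm
  set j := τ^[n + 1] i
  have hab : a j < b j := (ham j).trans (hmb j)
  have hcl : closure (Ioo (a j) (b j)) ⊆ Icc (a j) (b j) :=
    closure_minimal Ioo_subset_Icc_self isClosed_Icc
  have hjp : j ∈ Function.periodicPts τ := Function.mk_mem_periodicPts hk hper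
  have hp := Function.minimalPeriod_pos_of_mem_periodicPts hjp
  -- The minimal period is needed: it makes the visited cells distinct, hence the images disjoint.
  -- The images at positive times are single points, so their lengths vanish.
  refine ⟨Function.minimalPeriod τ j, a j, b j, n + 1, ⟨hp, hab, ?_, ?_, ?_⟩, hc j, ?_⟩
  · intro s hs t ht hst
    have hne : τ^[s] j ≠ τ^[t] j := fun h =>
      hst (Function.iterate_injOn_Iio_minimalPeriod hs ht h)
    refine (hd hne).mono ?_ ?_
    · rintro _ ⟨y, hy, rfl⟩; exact hit' s j y (hcl hy)
    · rintro _ ⟨y, hy, rfl⟩; exact hit' t j y (hcl hy)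
  · obtain ⟨q, hq⟩ : ∃ q, Function.minimalPeriod τ j = q + 1 := ⟨_, (Nat.sub_add_cancel hp).symm⟩
    have hj : τ^[q + 1] j = j := hq ▸ Function.iterate_minimalPeriod
    intro y hy
    change g^[Function.minimalPeriod τ j] y ∈ _
    rw [hq, hit q j y (hcl hy), hj]
    exact hm j
  · intro l hl h1
    obtain ⟨q, rfl⟩ := Nat.exists_eq_add_of_le' h1
    have : g^[q + 1] '' closure (Ioo (a j) (b j)) ⊆ {m (τ^[q + 1] j)} := by
      rintro _ ⟨y, hy, rfl⟩; exact hit q j y (hcl hy)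
    refine (measure_mono this).trans_lt ?_
    rw [measure_singleton, unitInterval.volume_Ioo]
    exact ENNReal.ofReal_pos.2 (sub_pos.2 hab)
  · change g^[n + 1] x ∈ _
    rw [hit n i x hx]; exact hm j

lemma exists_cells {N : ℕ} (hN : 0 < N) {η : ℝ} (hη : 0 < η) :
    ∃ a b m : Fin N → I, (∀ i, a i < m i) ∧ (∀ i, m i < b i) ∧
      Pairwise (Function.onFun Disjoint fun i => Icc (a i) (b i)) ∧
      (∀ i, (b i : ℝ) - a i ≤ 1 / N) ∧ (∀ y : I, ∃ i, dist (m i) y ≤ 1 / N) ∧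
      ENNReal.ofReal (1 - η) ≤ (volume : Measure I) (⋃ i, Icc (a i) (b i)) := by
  have hN' : (0 : ℝ) < N := by exact_mod_cast hN
  let pt : ∀ t : ℝ, 0 ≤ t → t ≤ 1 → Fin N → I := fun t h0 h1 i => ⟨(i + t) / N, by
    constructor
    · positivity
    · rw [div_le_one hN']
      have : ((i : ℕ) : ℝ) + 1 ≤ N := by exact_mod_cast i.2
      linarith⟩
  -- Each of the `N` equal subintervals loses a proportion `s` at both ends, so the total loss is `2
  -- * s ≤ η`. The bound `1 / 4` keeps the midpoint interior.
  obtain ⟨s, hs0, hs4, hsη⟩ : ∃ s : ℝ, 0 < s ∧ s ≤ 1 / 4 ∧ s ≤ η / 2 :=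
    ⟨min (1 / 4) (η / 2), by positivity, min_le_left _ _, min_le_right _ _⟩
  have hd : Pairwise (Function.onFun Disjoint fun i => Icc (pt s hs0.le (by linarith) i)
      (pt (1 - s) (by linarith) (by linarith) i)) := by
    intro i j hij
    refine disjoint_left.2 fun x hi hj => hij ?_
    have key : ∀ {i j : Fin N}, x ∈ Icc (pt s hs0.le (by linarith) i)
        (pt (1 - s) (by linarith) (by linarith) i) → x ∈ Icc (pt s hs0.le (by linarith) j)
        (pt (1 - s) (by linarith) (by linarith) j) → (i : ℕ) < j + 1 := by
      intro i j hi hj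
      have h1 : ((i : ℕ) + s) / N ≤ ((j : ℕ) + (1 - s)) / N :=
        Subtype.coe_le_coe.2 (hi.1.trans hj.2)
      rw [div_le_div_iff_of_pos_right hN'] at h1
      have : ((i : ℕ) : ℝ) < (j : ℕ) + 1 := by linarith
      exact_mod_cast this
    have h1 := key hi hj
    have h2 := key hj hi
    exact Fin.ext (by lia)
  refine ⟨pt s hs0.le (by linarith), pt (1 - s) (by linarith) (by linarith),
    pt (1 / 2) (by norm_num) (by norm_num), fun i => ?_, fun i => ?_, ?_, fun i => ?_, fun y => ?_, ?_⟩
  · refine Subtype.coe_lt_coe.1 ?_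
    simp only [pt]
    gcongr; linarith
  · refine Subtype.coe_lt_coe.1 ?_
    simp only [pt]
    gcongr; linarith
  · exact hd
  · simp only [pt]
    rw [← sub_div]
    gcongr; linarith
  -- The minimum handles `y = 1`, which belongs to the last subinterval.
  · have hfl : min ⌊(N : ℝ) * y⌋₊ (N - 1) < N := by lia
    refine ⟨⟨_, hfl⟩, ?_⟩
    have hy0 : 0 ≤ (N : ℝ) * y := mul_nonneg hN'.le y.2.1
    have h1 := Nat.floor_le hy0
    have h2 := Nat.lt_floor_add_one ((N : ℝ) * y)
    have h3 : (N : ℝ) * y ≤ N := mul_le_of_le_one_right hN'.le y.2.2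
    have h4 : ((N - 1 : ℕ) : ℝ) = N - 1 := by rw [Nat.cast_sub hN]; simp
    rw [Subtype.dist_eq, Real.dist_eq]
    simp only [pt]
    rw [show ∀ t : ℝ, t / N - y = (t - N * y) / N from fun t => by field_simp, abs_div,
      abs_of_pos hN']
    gcongr
    rw [Nat.cast_min, h4, abs_le]
    rcases min_cases (⌊(N : ℝ) * y⌋₊ : ℝ) ((N : ℝ) - 1) with h | h <;> rw [h.1] <;>
      constructor <;> linarith
  · rw [measure_iUnion hd fun i => measurableSet_Icc, tsum_fintype]
    have hv : ∀ i, (volume : Measure I) (Icc (pt s hs0.le (by linarith) i)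
        (pt (1 - s) (by linarith) (by linarith) i)) = ENNReal.ofReal ((1 - 2 * s) / N) := by
      intro i
      rw [unitInterval.volume_Icc]
      congr 1
      simp only [pt]
      ring
    simp only [hv, Finset.sum_const, Finset.card_univ, Fintype.card_fin]
    rw [← ENNReal.ofReal_nsmul, nsmul_eq_mul, mul_div_cancel₀ _ hN'.ne']
    exact ENNReal.ofReal_le_ofReal (by linarith)

lemma dense_lt_volume_capture {c : ℝ≥0∞} (hc : 0 < c) {d : ℝ≥0∞} (hd : d < 1) :
    Dense {f : C(I, I) | d < (volume : Measure I) {x | (f, x) ∈ capture c}} := by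
  refine Metric.dense_iff.2 fun f r hr => ?_
  obtain ⟨δ, hδ, hf⟩ := Metric.uniformContinuous_iff.1
    (CompactSpace.uniformContinuous_of_continuous f.continuous) (r / 3) (by linarith)
  obtain ⟨c', hc'0, hc'⟩ : ∃ c' : ℝ, 0 < c' ∧ ENNReal.ofReal c' < c := by
    obtain ⟨t, ht0, ht⟩ := ENNReal.lt_iff_exists_nnreal_btwn.1 hc
    exact ⟨t, by exact_mod_cast ht0, by simpa using ht⟩
  obtain ⟨η, hη, hdη⟩ : ∃ η : ℝ, 0 < η ∧ d < ENNReal.ofReal (1 - η) := by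
    have hd1 : d.toReal < 1 := ENNReal.toReal_lt_of_lt_ofReal (by simpa using hd)
    refine ⟨(1 - d.toReal) / 2, by linarith, ?_⟩
    rw [ENNReal.lt_ofReal_iff_toReal_lt hd.ne_top]
    linarith
  obtain ⟨n, hn⟩ := exists_nat_one_div_lt (lt_min (lt_min hδ hc'0) (show 0 < r / 3 by linarith))
  rw [lt_min_iff, lt_min_iff] at hn
  obtain ⟨⟨hnδ, hnc⟩, hnr⟩ := hn
  obtain ⟨a, b, m, ham, hmb, hdis, hlen, hnear, hvol⟩ := exists_cells n.succ_pos hη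
  push_cast at hlen hnear
  choose τ hτ using fun i => hnear (f (m i))
  -- One `r / 3` is the oscillation of `f` on a cell, the other the distance from `f (m i)` to the
  -- nearby marked point.
  have hclose : ∀ i, ∀ x ∈ Icc (a i) (b i), dist (m (τ i)) (f x) ≤ 2 * r / 3 := by
    intro i x hx
    have h1 : dist (m i) x < δ := by
      refine lt_of_le_of_lt ?_ hnδ
      refine le_trans ?_ (hlen i)
      rw [Subtype.dist_eq]
      exact Real.dist_le_of_mem_Icc ⟨(ham i).le, (hmb i).le⟩ hx
    have h2 := hf h1
    linarith [dist_triangle (m (τ i)) (f (m i)) (f x), hτ i]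
  obtain ⟨g, hgf, hg⟩ := exists_locally_constant_near f (fun i => isClosed_Icc) hdis
    (fun i => m (τ i)) (by positivity) hclose
  refine ⟨g, ?_, hdη.trans_le (hvol.trans (measure_mono fun x hx => ?_))⟩
  · rw [Metric.mem_ball]
    exact ((ContinuousMap.dist_le (by positivity)).2 hgf).trans_lt (by linarith)
  · obtain ⟨i, hi⟩ := mem_iUnion.1 hx
    refine mem_capture_of_constant_on_cells τ ham hmb hdis hg (fun j => ?_) hi
    rw [unitInterval.volume_Ioo]
    exact (ENNReal.ofReal_le_ofReal ((hlen j).trans hnc.le)).trans_lt hc'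

/-! ### Baire category and the theorem -/

lemma typical_ae_capture : Typical fun f : C(I, I) =>
    ∀ᵐ x ∂(volume : Measure I), ∀ q : ℕ, (f, x) ∈ capture (1 / (q : ℝ≥0∞)) := by
  have hlt : ∀ k : ℕ, 1 - ((k : ℝ≥0∞) + 1)⁻¹ < 1 := fun k =>
    ENNReal.sub_lt_self ENNReal.one_ne_top one_ne_zero (by simp)
  -- The index `z` pairs the length scale `q` with the measure defect `1 / (k + 1)`. For `q = 0` the
  -- length bound is `∞`, which is harmless.
  have hopen : ∀ z : ℕ × ℕ, IsOpen {f : C(I, I) | 1 - ((z.2 : ℝ≥0∞) + 1)⁻¹ <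
      (volume : Measure I) {x | (f, x) ∈ capture (1 / (z.1 : ℝ≥0∞))}} := fun z =>
    isOpen_setOf_lt_measure_section _ (isOpen_capture _) _
  refine ⟨_, IsGδ.iInter_of_isOpen hopen, dense_iInter_of_isOpen hopen fun z =>
    dense_lt_volume_capture (by simp) (hlt _), fun f hf => ae_all_iff.2 fun q => ?_⟩
  have hO : IsOpen {x | (f, x) ∈ capture (1 / (q : ℝ≥0∞))} :=
    (isOpen_capture _).preimage (Continuous.prodMk_right f)
  have h1 : (volume : Measure I) {x | (f, x) ∈ capture (1 / (q : ℝ≥0∞))} = 1 := by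
    refine le_antisymm prob_le_one ?_
    have ht : Tendsto (fun k : ℕ => 1 - ((k : ℝ≥0∞) + 1)⁻¹) atTop (𝓝 1) := by
      have := ENNReal.tendsto_inv_nat_nhds_zero.comp (tendsto_add_atTop_nat 1)
      simpa using ENNReal.Tendsto.sub tendsto_const_nhds this (Or.inl ENNReal.one_ne_top)
    exact le_of_tendsto ht (Eventually.of_forall fun k => (mem_iInter.1 hf (q, k)).le)
  exact (prob_compl_eq_zero_iff hO.measurableSet).2 h1

end PseudoPhysical

theorem mainTheorem8 (Ψ : ℕ → C(I, I)) (hΨ : DenseRange Ψ) :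
    PseudoPhysical.Typical fun f : C(I, I) =>
      (NullMeasurableSet (PseudoPhysical.AA₂ Ψ f) (volume : Measure I) ∧
        (volume : Measure I) (PseudoPhysical.AA₂ Ψ f) = 1) ∧
      PseudoPhysical.pseudoPhysical Ψ f =
        closure (PseudoPhysical.limitMeasure f '' PseudoPhysical.AA₂ Ψ f) ∧
      closure (PseudoPhysical.limitMeasure f '' PseudoPhysical.AA₂ Ψ f) =
        closure (PseudoPhysical.infinitelyShrinked f) := by
  obtain ⟨G, hG, hGd, h⟩ := PseudoPhysical.typical_ae_capture
  refine ⟨G, hG, hGd, fun f hf => PseudoPhysical.conclusion_of_ae hΨ ?_⟩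
  filter_upwards [h f hf] with x hx q _
  obtain ⟨p, a, b, n, hr, hv, hn⟩ := hx q
  exact ⟨p, Ioo a b, hr.isPeriodicShrinking, hv, n, hn⟩
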